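/- Let $L_n=\{0,1\}^n$ be the $n$-th level of the infinite rooted binary tree, in which each word of length $n+1$ is joined to the word of length $n$ obtained by deleting its last letter. For every $n\ge 0$ let $H_n$ be a simple graph with vertex set $L_n$, such that $H_n$ is $3$-regular for all $n\ge 2$ (no $3$-regular simple graph has fewer than $4$ vertices; $H_0$ and $H_1$ are arbitrary). Suppose that $(H_n)_{n\ge2}$ is an expander family, in at least one of the following two senses: (a) (spectral gaps bounded below) there is $\gamma>0$ such that for all $n\ge 2$ and all $f:L_n\to\mathbb R$ with $\sum_{x\in L_n} f(x)=0$, $$\sum_{x\in L_n} f(x)\Bigl(f(x)-\tfrac13\sum_{y\sim x\text{ in }H_n}f(y)\Bigr)\ \ge\ \gamma\sum_{x\in L_n} f(x)^2 ;$$ (b) (isoperimetric constants bounded below) there is $c>0$ such that for all $n\ge2$ and all nonempty $S\subseteq L_n$ with $|S|\le |L_n|/2$, the set of vertices of $L_n\setminus S$ having an $H_n$-neighbour in $S$ has at least $c|S|$ elements. Let $G$ be the graph obtained from the binary tree by adding, for every $n$, the edges of $H_n$ on the level $L_n$. Then: 1. every vertex of $G$ has degree at most $6$; 2. $G$ is nonamenable,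 i.e. has a positive Cheeger constant: there is $C>0$ such that $|\partial S|\ge C|S|$ for every finite nonempty set $S$ of vertices, where $\partial S$ is the set of vertices outside $S$ with a neighbour in $S$; 3. $G$ is Liouville: every bounded function $h$ from the vertices of $G$ to $\mathbb R$ whose value at each vertex is the average of its values at the neighbours of that vertex is constant. -/

import Mathlib

/-- The `n`-th level of the rooted binary tree: the `2 ^ n` binary words of length `n`. -/
abbrev Level (n : ℕ) : Type := Fin n → Bool

/-- The vertices of the infinite rooted binary tree: all finite binary words.  The root is the
empty word, i.e. the only element of level `0`. -/
abbrev TreeVertex : Type := Σ n : ℕ, Level n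

/-- The rooted binary tree: a word `x` of length `n + 1` is joined to its parent, which is obtained
by deleting the last letter of `x`. -/
def binaryTree : SimpleGraph TreeVertex :=
  SimpleGraph.fromRel fun u v =>
    ∃ (n : ℕ) (x : Level (n + 1)), u = ⟨n, Fin.init x⟩ ∧ v = ⟨n + 1, x⟩

/-- The disjoint union of the graphs `H n`, where `H n` is placed on the `n`-th level. -/
def levelEdges (H : ∀ n : ℕ, SimpleGraph (Level n)) : SimpleGraph TreeVertex :=
  SimpleGraph.fromRel fun u v =>
    ∃ (n : ℕ) (x y : Level n), u = ⟨n, x⟩ ∧ v = ⟨n, y⟩ ∧ (H n).Adj x y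

/-- The binary tree together with the edges of `H n` on the `n`-th level, for every `n`. -/
def treeWithLevels (H : ∀ n : ℕ, SimpleGraph (Level n)) : SimpleGraph TreeVertex :=
  binaryTree ⊔ levelEdges H

theorem treeWithLevels_adj_level_le (H : ∀ n : ℕ, SimpleGraph (Level n)) {u v : TreeVertex}
    (h : (treeWithLevels H).Adj u v) : v.1 ≤ u.1 + 1 := by
  simp only [treeWithLevels, binaryTree, levelEdges, SimpleGraph.sup_adj,
    SimpleGraph.fromRel_adj] at h
  rcases h with ⟨_, ⟨n, x, rfl, rfl⟩ | ⟨n, x, rfl, rfl⟩⟩ |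
    ⟨_, ⟨n, x, y, rfl, rfl, _⟩ | ⟨n, x, y, rfl, rfl, _⟩⟩ <;> simp <;> omega

theorem finite_treeVertex_level_le (m : ℕ) : {v : TreeVertex | v.1 ≤ m}.Finite := by
  have h : {v : TreeVertex | v.1 ≤ m} =
      ⋃ n ∈ Set.Iic m, Set.range (fun x : Level n => (⟨n, x⟩ : TreeVertex)) := by
    ext ⟨n, x⟩
    simp only [Set.mem_ofPred_eq, Set.mem_iUnion, Set.mem_Iic, Set.mem_range]
    constructor
    · intro hn
      exact ⟨n, hn, x, rfl⟩
    · rintro ⟨k, hk, y, hy⟩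
      have : k = n := congrArg Sigma.fst hy
      omega
  rw [h]
  exact (Set.finite_Iic m).biUnion fun n _ => Set.finite_range _

noncomputable instance treeWithLevels_locallyFinite (H : ∀ n : ℕ, SimpleGraph (Level n)) :
    (treeWithLevels H).LocallyFinite := fun u =>
  ((finite_treeVertex_level_le (u.1 + 1)).subset fun _ hv =>
    treeWithLevels_adj_level_le H hv).fintype

/-- The vertex boundary of `S`: the vertices outside `S` that have a neighbour in `S`. -/
def vertexBoundary {V : Type*} (G : SimpleGraph V) (S : Finset V) : Set V :=
  {v | v ∉ S ∧ ∃ u ∈ S, G.Adj u v}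

/-- A locally finite graph is nonamenable (has a positive Cheeger constant) if `|∂S| / |S|` is
bounded below by a positive constant over all finite nonempty sets `S` of vertices. -/
def IsNonamenableGraph {V : Type*} (G : SimpleGraph V) [G.LocallyFinite] : Prop :=
  ∃ C : ℝ, 0 < C ∧ ∀ S : Finset V, S.Nonempty →
    C * (S.card : ℝ) ≤ ((vertexBoundary G S).ncard : ℝ)

/-- `h` is harmonic if its value at each vertex is its average over the neighbours. -/
def IsGraphHarmonic {V : Type*} (G : SimpleGraph V) [G.LocallyFinite] (h : V → ℝ) : Prop :=
  ∀ v : V, (G.degree v : ℝ) * h v = ∑ w ∈ G.neighborFinset v, h w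

/-- A graph is Liouville if all its bounded harmonic functions are constant. -/
def IsLiouvilleGraph {V : Type*} (G : SimpleGraph V) [G.LocallyFinite] : Prop :=
  ∀ h : V → ℝ, IsGraphHarmonic G h → (∃ M : ℝ, ∀ v : V, |h v| ≤ M) → ∀ u v : V, h u = h v

/-- The spectral gap of the finite `d`-regular graph `G` is at least `γ`: with
`P f x = d⁻¹ * ∑ y ~ x, f y` the Markov operator of simple random walk, one has
`⟪f, (1 - P) f⟫ ≥ γ * ‖f‖ ^ 2` for all `f` with mean zero.  Equivalently, the second largest
eigenvalue of `P` (with multiplicity) is at most `1 - γ`; no condition is put on the negative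
eigenvalues. -/
def SpectralGapAtLeast {V : Type*} [Fintype V] (G : SimpleGraph V) [G.LocallyFinite]
    (d : ℕ) (γ : ℝ) : Prop :=
  ∀ f : V → ℝ, ∑ x, f x = 0 →
    γ * ∑ x, f x ^ 2 ≤ ∑ x, f x * (f x - (∑ y ∈ G.neighborFinset x, f y) / (d : ℝ))

/-- The isoperimetric form of expansion of a finite graph: `|∂S| ≥ c * |S|` for all nonempty sets
`S` that contain at most half of the vertices. -/
def VertexExpansionAtLeast {V : Type*} [Fintype V] (G : SimpleGraph V) (c : ℝ) : Prop :=
  ∀ S : Finset V, S.Nonempty → 2 * S.card ≤ Fintype.card V →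
    c * (S.card : ℝ) ≤ ((vertexBoundary G S).ncard : ℝ)

/-- The graphs `H n` are `3`-regular expanders on the levels, uniformly in the level, in either of
the two usual senses: spectral gaps bounded below, or isoperimetric constants bounded below.
The condition is on the levels `n ≥ 2`, since no `3`-regular simple graph has fewer than four
vertices; `H 0` and `H 1` are arbitrary. -/
def IsCubicExpanderFamily (H : ∀ n : ℕ, SimpleGraph (Level n)) [∀ n, (H n).LocallyFinite] : Prop :=
  (∀ n, 2 ≤ n → (H n).IsRegularOfDegree 3) ∧
    ((∃ γ : ℝ, 0 < γ ∧ ∀ n, 2 ≤ n → SpectralGapAtLeast (H n) 3 γ) ∨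
      (∃ c : ℝ, 0 < c ∧ ∀ n, 2 ≤ n → VertexExpansionAtLeast (H n) c))

/-! Nonamenability needs only the tree, where children are distinct. For the Liouville property,
split a bounded harmonic `h` on each level into its mean and its deviation from the mean. The means
satisfy a linear recursion with solutions `α + β * 2 ^ (-n)`, so they converge
(`exists_levelMean_tendsto`). Pairing the harmonic equation with the deviation and using the
spectral gap gives a strict recursion for its Euclidean norm (`levelNorm_recursion`).

Boundedness allows growth like `√2 ^ n`, but after dividing by this factor a bounded solution of the
recursion must at least halve at each step (`two_mul_succ_le_of_recursion`). The norm itself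
therefore decays like `(√2 / 2) ^ n`, and it dominates the sup norm. So `h` tends uniformly to a
constant at infinity, and the maximum principle (`le_of_tendsto`) finishes. The isoperimetric
hypothesis reduces to the spectral one by Cheeger's inequality. -/

/-! ### Children, neighbourhoods and degrees. -/

/-- The child of the word `x` obtained by appending the letter `b`. -/
def childLevel {n : ℕ} (x : Level n) (b : Bool) : Level (n + 1) :=
  Fin.snoc (α := fun _ => Bool) x b

@[simp] theorem init_childLevel {n : ℕ} (x : Level n) (b : Bool) :
    Fin.init (childLevel x b) = x :=
  Fin.init_snoc (α := fun _ => Bool) b x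

theorem childLevel_injective {n : ℕ} {x y : Level n} {a b : Bool}
    (h : childLevel x a = childLevel y b) : x = y ∧ a = b :=
  Fin.snoc_inj (α := fun _ => Bool) |>.1 h

theorem init_eq_iff {n : ℕ} {x : Level n} {y : Level (n + 1)} :
    Fin.init y = x ↔ y = childLevel x false ∨ y = childLevel x true := by
  constructor
  · rintro rfl
    have h : childLevel (Fin.init y) (y (Fin.last n)) = y :=
      Fin.snoc_init_self (α := fun _ => Bool) y
    cases hb : y (Fin.last n) <;> rw [hb] at h
    · exact Or.inl h.symm
    · exact Or.inr h.symm
  · rintro (rfl | rfl) <;> simp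

theorem sum_level_succ {n : ℕ} (F : Level (n + 1) → ℝ) :
    ∑ y, F y = ∑ x : Level n, (F (childLevel x false) + F (childLevel x true)) := by
  rw [← (Fin.snocEquiv (n := n) fun _ => Bool).sum_comp, Fintype.sum_prod_type,
    Fintype.sum_bool, add_comm, ← Finset.sum_add_distrib]
  rfl

theorem sum_level_init {n : ℕ} (F : Level n → ℝ) :
    ∑ y : Level (n + 1), F (Fin.init y) = 2 * ∑ x, F x := by
  rw [sum_level_succ, Finset.mul_sum]
  exact Finset.sum_congr rfl fun x _ => by simp; ring

theorem treeWithLevels_adj_succ (H : ∀ n : ℕ, SimpleGraph (Level n)) {n : ℕ} (x : Level n)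
    (y : Level (n + 1)) : (treeWithLevels H).Adj ⟨n, x⟩ ⟨n + 1, y⟩ ↔ Fin.init y = x := by
  simp only [treeWithLevels, binaryTree, levelEdges, SimpleGraph.sup_adj,
    SimpleGraph.fromRel_adj]
  constructor
  · rintro (⟨_, ⟨m, z, h1, h2⟩ | ⟨m, z, h1, h2⟩⟩ |
      ⟨_, ⟨m, z, w, h1, h2, _⟩ | ⟨m, z, w, h1, h2, _⟩⟩)
    · obtain rfl : n = m := congrArg Sigma.fst h1
      obtain rfl := eq_of_heq (Sigma.mk.inj h1).2
      obtain rfl := eq_of_heq (Sigma.mk.inj h2).2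
      rfl
    all_goals
      have e1 := congrArg Sigma.fst h1
      have e2 := congrArg Sigma.fst h2
      simp only at e1 e2
      omega
  · rintro rfl
    exact Or.inl ⟨fun h => by simpa using congrArg Sigma.fst h, Or.inl ⟨n, y, rfl, rfl⟩⟩

theorem treeWithLevels_adj_same (H : ∀ n : ℕ, SimpleGraph (Level n)) {n : ℕ} (x y : Level n) :
    (treeWithLevels H).Adj ⟨n, x⟩ ⟨n, y⟩ ↔ (H n).Adj x y := by
  simp only [treeWithLevels, binaryTree, levelEdges, SimpleGraph.sup_adj,
    SimpleGraph.fromRel_adj]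
  constructor
  · rintro (⟨_, ⟨m, z, h1, h2⟩ | ⟨m, z, h1, h2⟩⟩ |
      ⟨_, ⟨m, z, w, h1, h2, h⟩ | ⟨m, z, w, h1, h2, h⟩⟩)
    iterate 2
      have e1 := congrArg Sigma.fst h1
      have e2 := congrArg Sigma.fst h2
      simp only at e1 e2
      omega
    all_goals
      obtain rfl : n = m := congrArg Sigma.fst h1
      obtain rfl := eq_of_heq (Sigma.mk.inj h1).2
      obtain rfl := eq_of_heq (Sigma.mk.inj h2).2
    · exact h
    · exact h.symm
  · intro h
    refine Or.inr ⟨fun e => h.ne (eq_of_heq (Sigma.mk.inj e).2), Or.inl ⟨n, x, y, rfl, rfl, h⟩⟩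

/-- Serves twice: `φ = 1` gives the degrees, `φ = h` the harmonic equation off the root. -/
theorem sum_neighborFinset_succ (H : ∀ n : ℕ, SimpleGraph (Level n))
    [∀ n, (H n).LocallyFinite] (φ : TreeVertex → ℝ) {n : ℕ} (x : Level (n + 1)) :
    ∑ w ∈ (treeWithLevels H).neighborFinset ⟨n + 1, x⟩, φ w =
      φ ⟨n, Fin.init x⟩ + (φ ⟨n + 2, childLevel x false⟩ + φ ⟨n + 2, childLevel x true⟩) +
        ∑ y ∈ (H (n + 1)).neighborFinset x, φ ⟨n + 1, y⟩ := by
  classical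
  have key : (treeWithLevels H).neighborFinset ⟨n + 1, x⟩ =
      insert ⟨n, Fin.init x⟩ (insert ⟨n + 2, childLevel x false⟩
        (insert ⟨n + 2, childLevel x true⟩
          (((H (n + 1)).neighborFinset x).map (Function.Embedding.sigmaMk (n + 1))))) := by
    ext ⟨m, y⟩
    simp only [SimpleGraph.mem_neighborFinset, Finset.mem_insert, Finset.mem_map,
      Function.Embedding.sigmaMk_apply]
    constructor
    · intro h
      have h1 := treeWithLevels_adj_level_le H h
      have h2 := treeWithLevels_adj_level_le H h.symm
      simp only at h1 h2
      obtain rfl | rfl | rfl : m = n ∨ m = n + 1 ∨ m = n + 2 := by omega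
      · rw [SimpleGraph.adj_comm, treeWithLevels_adj_succ] at h
        exact Or.inl (by rw [h])
      · rw [treeWithLevels_adj_same] at h
        exact Or.inr (Or.inr (Or.inr ⟨y, h, rfl⟩))
      · rw [treeWithLevels_adj_succ, init_eq_iff] at h
        rcases h with rfl | rfl <;> simp
    · rintro (h | h | h | ⟨z, hz, h⟩)
      · rw [h, SimpleGraph.adj_comm, treeWithLevels_adj_succ]
      · rw [h, treeWithLevels_adj_succ, init_childLevel]
      · rw [h, treeWithLevels_adj_succ, init_childLevel]
      · rw [← h, treeWithLevels_adj_same]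
        exact hz
  rw [key, Finset.sum_insert, Finset.sum_insert, Finset.sum_insert, Finset.sum_map]
  · simp only [Function.Embedding.sigmaMk_apply]
    ring
  · simp
  · simp only [Finset.mem_insert, Finset.mem_map, Function.Embedding.sigmaMk_apply, not_or]
    refine ⟨fun h => ?_, by simp⟩
    simpa using (childLevel_injective (eq_of_heq (Sigma.mk.inj h).2)).2
  · simp

theorem childLevel_mem_neighborFinset (H : ∀ n : ℕ, SimpleGraph (Level n)) {n : ℕ}
    (x : Level n) (b : Bool) :
    (⟨n + 1, childLevel x b⟩ : TreeVertex) ∈ (treeWithLevels H).neighborFinset ⟨n, x⟩ := by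
  rw [SimpleGraph.mem_neighborFinset, treeWithLevels_adj_succ, init_childLevel]

theorem degree_treeWithLevels_succ (H : ∀ n : ℕ, SimpleGraph (Level n))
    [∀ n, (H n).LocallyFinite] {n : ℕ} (x : Level (n + 1)) :
    (treeWithLevels H).degree ⟨n + 1, x⟩ = 3 + (H (n + 1)).degree x := by
  have h := sum_neighborFinset_succ H (fun _ => 1) x
  simp only [Finset.sum_const, SimpleGraph.card_neighborFinset_eq_degree, nsmul_eq_mul,
    mul_one] at h
  have h' : ((treeWithLevels H).degree ⟨n + 1, x⟩ : ℝ) = ((3 + (H (n + 1)).degree x : ℕ) : ℝ) := by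
    rw [h]; push_cast; ring
  exact_mod_cast h'

theorem degree_treeWithLevels_root_le (H : ∀ n : ℕ, SimpleGraph (Level n)) (x : Level 0) :
    (treeWithLevels H).degree ⟨0, x⟩ ≤ 2 := by
  classical
  rw [← SimpleGraph.card_neighborFinset_eq_degree]
  refine (Finset.card_le_card (t := {⟨1, childLevel x false⟩, ⟨1, childLevel x true⟩})
    fun ⟨m, y⟩ h => ?_).trans Finset.card_le_two
  rw [SimpleGraph.mem_neighborFinset] at h
  have h1 := treeWithLevels_adj_level_le H h
  simp only at h1
  obtain rfl | rfl : m = 0 ∨ m = 1 := by omega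
  · exact absurd (congrArg (Sigma.mk 0) (Subsingleton.elim x y)) h.ne
  · rw [treeWithLevels_adj_succ, init_eq_iff] at h
    rcases h with rfl | rfl <;> simp

theorem degree_treeWithLevels_le (H : ∀ n : ℕ, SimpleGraph (Level n))
    [∀ n, (H n).LocallyFinite] (hreg : ∀ n, 2 ≤ n → (H n).IsRegularOfDegree 3)
    (v : TreeVertex) : (treeWithLevels H).degree v ≤ 6 := by
  obtain ⟨n, x⟩ := v
  match n, x with
  | 0, x => exact (degree_treeWithLevels_root_le H x).trans (by norm_num)
  | 1, x =>
    -- Level `1` has two vertices, so the arbitrary graph `H 1` adds at most one to the degree.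
    have h : (H 1).degree x < Fintype.card (Level 1) :=
      Finset.card_lt_univ_of_notMem ((H 1).notMem_neighborFinset_self x)
    rw [Fintype.card_fun, Fintype.card_bool, Fintype.card_fin] at h
    rw [degree_treeWithLevels_succ]
    change 3 + (H 1).degree x ≤ 6
    omega
  | n + 2, x => rw [degree_treeWithLevels_succ, (hreg (n + 2) (by omega)).degree_eq x]

/-- The vertices of `S` have `2 * |S|` distinct children, and at most `|S|` of these lie in `S`. -/
theorem isNonamenableGraph_treeWithLevels (H : ∀ n : ℕ, SimpleGraph (Level n)) :
    IsNonamenableGraph (treeWithLevels H) := by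
  classical
  refine ⟨1, one_pos, fun S _ => ?_⟩
  rw [one_mul, Nat.cast_le]
  let e : TreeVertex × Bool ↪ TreeVertex :=
    ⟨fun p => ⟨p.1.1 + 1, childLevel p.1.2 p.2⟩, by
      rintro ⟨⟨n, x⟩, a⟩ ⟨⟨m, y⟩, b⟩ h
      obtain rfl : n = m := by simpa using congrArg Sigma.fst h
      obtain ⟨rfl, rfl⟩ := childLevel_injective (eq_of_heq (Sigma.mk.inj h).2)
      rfl⟩
  let T : Finset TreeVertex := (S ×ˢ Finset.univ).map e
  have hT : T.card = S.card * 2 := by simp [T]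
  have hsub : ((T \ S : Finset TreeVertex) : Set TreeVertex) ⊆
      vertexBoundary (treeWithLevels H) S := by
    intro v hv
    rw [Finset.mem_coe, Finset.mem_sdiff, Finset.mem_map] at hv
    obtain ⟨⟨p, hp, rfl⟩, hv⟩ := hv
    refine ⟨hv, p.1, (Finset.mem_product.1 hp).1, ?_⟩
    exact (SimpleGraph.mem_neighborFinset _ _ _).1 (childLevel_mem_neighborFinset H p.1.2 p.2)
  have hfin : (vertexBoundary (treeWithLevels H) S).Finite := by
    refine (S.biUnion fun u => (treeWithLevels H).neighborFinset u).finite_toSet.subset ?_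
    rintro v ⟨_, u, hu, huv⟩
    exact Finset.mem_coe.2 (Finset.mem_biUnion.2
      ⟨u, hu, (SimpleGraph.mem_neighborFinset _ _ _).2 huv⟩)
  have h1 := Set.ncard_le_ncard hsub hfin
  rw [Set.ncard_coe_finset] at h1
  have h2 := Finset.le_card_sdiff S T
  omega

/-! ### Cheeger's inequality for vertex boundaries. -/

theorem exists_median {V : Type*} [Fintype V] [Nonempty V] (f : V → ℝ) :
    ∃ m : ℝ, 2 * (Finset.univ.filter fun x => m < f x).card ≤ Fintype.card V ∧
      2 * (Finset.univ.filter fun x => f x < m).card ≤ Fintype.card V := by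
  classical
  let T : Finset V := Finset.univ.filter fun x =>
    2 * (Finset.univ.filter fun y => f x < f y).card ≤ Fintype.card V
  have hT : T.Nonempty := by
    obtain ⟨x, -, hx⟩ := Finset.exists_max_image Finset.univ f Finset.univ_nonempty
    refine ⟨x, Finset.mem_filter.2 ⟨Finset.mem_univ _, ?_⟩⟩
    rw [Finset.filter_eq_empty_iff.2 fun y _ => not_lt.2 (hx y (Finset.mem_univ _))]
    simp
  obtain ⟨x, hxT, hx⟩ := Finset.exists_min_image T f hT
  refine ⟨f x, (Finset.mem_filter.1 hxT).2, ?_⟩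
  rcases (Finset.univ.filter fun y => f y < f x).eq_empty_or_nonempty with h0 | h0
  · simp [h0]
  -- The next lower value `f y` has more than half of the vertices strictly above it, and none of
  -- those lies strictly below `f x`.
  obtain ⟨y, hy, hmax⟩ := Finset.exists_max_image _ f h0
  have hyx : f y < f x := (Finset.mem_filter.1 hy).2
  have hyT : y ∉ T := fun h => (hx y h).not_gt hyx
  have h1 : Fintype.card V < 2 * (Finset.univ.filter fun z => f y < f z).card := by
    simpa [T] using hyT
  have hdisj : Disjoint (Finset.univ.filter fun z => f y < f z)
      (Finset.univ.filter fun z => f z < f x) := by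
    rw [Finset.disjoint_left]
    intro z hz hz'
    exact (hmax z hz').not_gt (Finset.mem_filter.1 hz).2
  have h2 := Finset.card_le_univ ((Finset.univ.filter fun z => f y < f z) ∪
      (Finset.univ.filter fun z => f z < f x))
  rw [Finset.card_union_of_disjoint hdisj] at h2
  omega

section Cheeger

variable {V : Type*} (G : SimpleGraph V) [G.LocallyFinite]

theorem sum_sum_neighborFinset_comm [Fintype V] (F : V → V → ℝ) :
    ∑ x, ∑ y ∈ G.neighborFinset x, F x y = ∑ x, ∑ y ∈ G.neighborFinset x, F y x :=
  Finset.sum_comm' fun x y => by simp [SimpleGraph.adj_comm]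

theorem ncard_vertexBoundary_le_sum [DecidableEq V] (S : Finset V) :
    ((vertexBoundary G S).ncard : ℝ) ≤
      ∑ x ∈ S, ∑ y ∈ G.neighborFinset x, if y ∈ S then (0 : ℝ) else 1 := by
  have h : vertexBoundary G S = ↑(S.biUnion fun x => (G.neighborFinset x).filter (· ∉ S)) := by
    ext v
    simp only [vertexBoundary, Set.mem_ofPred_eq, Finset.coe_biUnion, Set.mem_iUnion,
      Finset.mem_coe, Finset.mem_filter, SimpleGraph.mem_neighborFinset]
    constructor
    · rintro ⟨hv, u, hu, huv⟩
      exact ⟨u, hu, huv, hv⟩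
    · rintro ⟨u, hu, huv, hv⟩
      exact ⟨hv, u, hu, huv⟩
  rw [h, Set.ncard_coe_finset]
  refine (Nat.cast_le.2 Finset.card_biUnion_le).trans (le_of_eq ?_)
  push_cast
  refine Finset.sum_congr rfl fun x _ => ?_
  rw [Finset.card_filter]
  push_cast
  exact Finset.sum_congr rfl fun y _ => by split_ifs <;> simp_all

variable {G} [Fintype V]

/-- Discrete co-area inequality, by peeling off the lowest layer of `w`. -/
theorem VertexExpansionAtLeast.mul_sum_le {c : ℝ} (hG : VertexExpansionAtLeast G c) (w : V → ℝ)
    (hw : ∀ x, 0 ≤ w x)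
    (hsupp : 2 * (Finset.univ.filter fun x => 0 < w x).card ≤ Fintype.card V) :
    c * ∑ x, w x ≤ ∑ x, ∑ y ∈ G.neighborFinset x, max (w x - w y) 0 := by
  classical
  induction hk : (Finset.univ.filter fun x => 0 < w x).card using Nat.strong_induction_on
    generalizing w with
  | _ k ih =>
  set S := Finset.univ.filter fun x => 0 < w x with hS
  have hmem : ∀ x, x ∈ S ↔ 0 < w x := fun x => by simp [hS]
  rcases S.eq_empty_or_nonempty with h0 | h0
  · have hz : ∀ x, w x = 0 := fun x =>
      le_antisymm (not_lt.1 fun h => by simpa [h0] using (hmem x).2 h) (hw x)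
    simp [hz]
  obtain ⟨a, ha, hmin⟩ := Finset.exists_min_image S w h0
  have hapos : 0 < w a := (hmem a).1 ha
  -- Lowering `w` by its least positive value shrinks the support. The sum drops by `|S| * w a`, the
  -- gradient by `w a` times the number of edges leaving `S`.
  let w' : V → ℝ := fun x => if x ∈ S then w x - w a else 0
  have hw' : ∀ x, 0 ≤ w' x := fun x => by
    by_cases hx : x ∈ S
    · simpa [w', hx] using hmin x hx
    · simp [w', hx]
  have hss : (Finset.univ.filter fun x => 0 < w' x) ⊂ S := by
    refine Finset.ssubset_iff_subset_ne.2 ⟨fun x hx => ?_, fun h => ?_⟩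
    · by_contra hxS
      simp [w', hxS] at hx
    · rw [← h] at ha
      simp [w'] at ha
  have hlt := Finset.card_lt_card hss
  have key := ih _ (hk ▸ hlt) w' hw' (by omega) rfl
  have hsum : ∑ x, w x = ∑ x, w' x + S.card * w a := by
    have : ∀ x, w x = w' x + if x ∈ S then w a else 0 := fun x => by
      by_cases hx : x ∈ S
      · simp [w', hx]
      · have : w x = 0 := le_antisymm (not_lt.1 fun h => hx ((hmem x).2 h)) (hw x)
        simp [w', hx, this]
    rw [Finset.sum_congr rfl fun x _ => this x, Finset.sum_add_distrib]
    simp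
  have hgrad : ∑ x, ∑ y ∈ G.neighborFinset x, max (w x - w y) 0 =
      ∑ x, ∑ y ∈ G.neighborFinset x, max (w' x - w' y) 0 +
        w a * ∑ x ∈ S, ∑ y ∈ G.neighborFinset x, if y ∈ S then (0 : ℝ) else 1 := by
    have : ∀ x y, max (w x - w y) 0 = max (w' x - w' y) 0 +
        if x ∈ S then w a * (if y ∈ S then (0 : ℝ) else 1) else 0 := fun x y => by
      have hz : ∀ z, z ∉ S → w z = 0 := fun z hz =>
        le_antisymm (not_lt.1 fun h => hz ((hmem z).2 h)) (hw z)
      by_cases hx : x ∈ S <;> by_cases hy : y ∈ S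
      · simp [w', hx, hy]
      · have := hmin x hx
        simp [w', hx, hy, hz y hy, hw x, this]
      · have := hmin y hy
        simp [w', hx, hy, hz x hx, hw y, this]
      · simp [w', hx, hy, hz x hx, hz y hy]
    simp_rw [this, Finset.sum_add_distrib]
    congr 1
    rw [Finset.mul_sum, ← Finset.sum_filter_add_sum_filter_not Finset.univ (· ∈ S)]
    rw [Finset.filter_mem_eq_inter, Finset.univ_inter]
    rw [Finset.sum_eq_zero (s := Finset.univ.filter fun x => x ∉ S), add_zero]
    · refine Finset.sum_congr rfl fun x hx => ?_
      simp [hx, Finset.mul_sum]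
    · intro x hx
      simp [(Finset.mem_filter.1 hx).2]
  have hexp := (hG S h0 hsupp).trans (ncard_vertexBoundary_le_sum G S)
  rw [hsum, hgrad]
  nlinarith [mul_le_mul_of_nonneg_left hexp hapos.le]

theorem sum_sum_neighborFinset_left {d : ℕ} (hreg : G.IsRegularOfDegree d) (F : V → ℝ) :
    ∑ x, ∑ _y ∈ G.neighborFinset x, F x = d * ∑ x, F x := by
  rw [Finset.mul_sum]
  exact Finset.sum_congr rfl fun x _ => by simp [hreg.degree_eq x]

theorem sum_sum_neighborFinset_right {d : ℕ} (hreg : G.IsRegularOfDegree d) (F : V → ℝ) :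
    ∑ x, ∑ y ∈ G.neighborFinset x, F y = d * ∑ x, F x := by
  rw [sum_sum_neighborFinset_comm G fun _ y => F y, sum_sum_neighborFinset_left hreg]

/-- Apply the co-area inequality to `u ^ 2`, factor `u x ^ 2 - u y ^ 2`, and use Cauchy–Schwarz; the
factor `u x + u y` costs `4 * d * ∑ u ^ 2`. -/
theorem VertexExpansionAtLeast.sq_mul_sum_sq_le {c : ℝ} (hc : 0 ≤ c) {d : ℕ}
    (hreg : G.IsRegularOfDegree d) (hG : VertexExpansionAtLeast G c) (u : V → ℝ)
    (hu : ∀ x, 0 ≤ u x)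
    (hsupp : 2 * (Finset.univ.filter fun x => 0 < u x).card ≤ Fintype.card V) :
    c ^ 2 * ∑ x, u x ^ 2 ≤ 4 * d * ∑ x, ∑ y ∈ G.neighborFinset x, (u x - u y) ^ 2 := by
  set Q := ∑ x, u x ^ 2 with hQ
  set E := ∑ x, ∑ y ∈ G.neighborFinset x, (u x - u y) ^ 2 with hE
  have hQ0 : 0 ≤ Q := Finset.sum_nonneg fun x _ => sq_nonneg _
  have hE0 : 0 ≤ E := Finset.sum_nonneg fun x _ => Finset.sum_nonneg fun y _ => sq_nonneg _
  have h1 := hG.mul_sum_le (fun x => u x ^ 2) (fun x => sq_nonneg _) (by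
    have : (Finset.univ.filter fun x => 0 < u x ^ 2) = Finset.univ.filter fun x => 0 < u x :=
      Finset.filter_congr fun x _ =>
        ⟨fun h => (hu x).lt_of_ne fun e => by simp [← e] at h, fun h => by positivity⟩
    rwa [this])
  have h2 : ∑ x, ∑ y ∈ G.neighborFinset x, max (u x ^ 2 - u y ^ 2) 0 ≤
      ∑ x, ∑ y ∈ G.neighborFinset x, |u x - u y| * (u x + u y) := by
    refine Finset.sum_le_sum fun x _ => Finset.sum_le_sum fun y _ => ?_
    have := hu x
    have := hu y
    refine max_le ?_ (by positivity)
    nlinarith [mul_le_mul_of_nonneg_right (le_abs_self (u x - u y)) (add_nonneg (hu x) (hu y))]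
  have h3 : (∑ x, ∑ y ∈ G.neighborFinset x, |u x - u y| * (u x + u y)) ^ 2 ≤
      E * (4 * d * Q) := by
    have hcs := Finset.sum_mul_sq_le_sq_mul_sq
      ((Finset.univ : Finset V).sigma fun x => G.neighborFinset x)
      (fun p => |u p.1 - u p.2|) (fun p => u p.1 + u p.2)
    simp only [Finset.sum_sigma, sq_abs] at hcs
    refine hcs.trans (mul_le_mul_of_nonneg_left ?_ hE0)
    have : ∑ x, ∑ y ∈ G.neighborFinset x, (u x + u y) ^ 2 ≤
        ∑ x, ∑ y ∈ G.neighborFinset x, (2 * u x ^ 2 + 2 * u y ^ 2) :=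
      Finset.sum_le_sum fun x _ => Finset.sum_le_sum fun y _ => by
        nlinarith [sq_nonneg (u x - u y)]
    refine this.trans (le_of_eq ?_)
    simp_rw [Finset.sum_add_distrib]
    rw [sum_sum_neighborFinset_left hreg fun x => 2 * u x ^ 2,
      sum_sum_neighborFinset_right hreg fun x => 2 * u x ^ 2, ← Finset.mul_sum]
    ring
  have h4 : (c * Q) ^ 2 ≤ E * (4 * d * Q) :=
    (pow_le_pow_left₀ (mul_nonneg hc hQ0) (h1.trans h2) 2).trans h3
  rcases hQ0.eq_or_lt with h0 | h0
  · rw [← h0, mul_zero]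
    positivity
  · refine le_of_mul_le_mul_right ?_ h0
    linarith

theorem sum_mul_sub_eq_dirichlet {d : ℕ} (hd : d ≠ 0) (hreg : G.IsRegularOfDegree d)
    (f : V → ℝ) :
    2 * d * ∑ x, f x * (f x - (∑ y ∈ G.neighborFinset x, f y) / (d : ℝ)) =
      ∑ x, ∑ y ∈ G.neighborFinset x, (f x - f y) ^ 2 := by
  have hd' : (d : ℝ) ≠ 0 := Nat.cast_ne_zero.2 hd
  have h1 : ∀ x y, (f x - f y) ^ 2 = f x ^ 2 + f y ^ 2 - 2 * (f x * f y) := fun x y => by ring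
  simp_rw [h1, Finset.sum_sub_distrib, Finset.sum_add_distrib]
  rw [sum_sum_neighborFinset_left hreg fun x => f x ^ 2,
      sum_sum_neighborFinset_right hreg fun x => f x ^ 2, ← two_mul, ← mul_assoc,
      Finset.mul_sum, Finset.mul_sum, ← Finset.sum_sub_distrib]
  refine Finset.sum_congr rfl fun x _ => ?_
  rw [← Finset.mul_sum, ← Finset.mul_sum]
  field_simp

/-- Cheeger's inequality for regular graphs, with vertex boundaries. -/
theorem VertexExpansionAtLeast.spectralGapAtLeast {c : ℝ} (hc : 0 ≤ c) {d : ℕ} (hd : d ≠ 0)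
    (hreg : G.IsRegularOfDegree d) (hG : VertexExpansionAtLeast G c) :
    SpectralGapAtLeast G d (c ^ 2 / (8 * d ^ 2)) := by
  intro f hf
  rcases isEmpty_or_nonempty V with _ | _
  · simp
  have hd' : (0 : ℝ) < d := by positivity
  -- Cutting at a median makes both the positive and the negative part of `f - m` live on at most
  -- half of the vertices.
  obtain ⟨m, hm1, hm2⟩ := exists_median f
  have hp := hG.sq_mul_sum_sq_le hc hreg (fun x => max (f x - m) 0) (fun x => le_max_right _ _)
    (by simpa using hm1)
  have hn := hG.sq_mul_sum_sq_le hc hreg (fun x => max (m - f x) 0) (fun x => le_max_right _ _)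
    (by simpa using hm2)
  -- As `f` has mean zero, subtracting `m` cannot decrease its norm.
  have hsq : ∑ x, f x ^ 2 ≤ ∑ x, max (f x - m) 0 ^ 2 + ∑ x, max (m - f x) 0 ^ 2 := by
    have : ∀ x, max (f x - m) 0 ^ 2 + max (m - f x) 0 ^ 2 = f x ^ 2 - 2 * m * f x + m ^ 2 := by
      intro x
      rcases le_total (f x) m with h | h
      · rw [max_eq_right (sub_nonpos.2 h), max_eq_left (sub_nonneg.2 h)]; ring
      · rw [max_eq_left (sub_nonneg.2 h), max_eq_right (sub_nonpos.2 h)]; ring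
    rw [← Finset.sum_add_distrib, Finset.sum_congr rfl fun x _ => this x,
      Finset.sum_add_distrib, Finset.sum_sub_distrib, ← Finset.mul_sum, hf]
    have : 0 ≤ ∑ _x : V, m ^ 2 := Finset.sum_nonneg fun _ _ => sq_nonneg _
    linarith
  have hen : ∑ x, ∑ y ∈ G.neighborFinset x, (max (f x - m) 0 - max (f y - m) 0) ^ 2 +
      ∑ x, ∑ y ∈ G.neighborFinset x, (max (m - f x) 0 - max (m - f y) 0) ^ 2 ≤
      ∑ x, ∑ y ∈ G.neighborFinset x, (f x - f y) ^ 2 := by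
    simp_rw [← Finset.sum_add_distrib]
    refine Finset.sum_le_sum fun x _ => Finset.sum_le_sum fun y _ => ?_
    rcases le_total (f x) m with h | h <;> rcases le_total (f y) m with h' | h'
    · rw [max_eq_right (sub_nonpos.2 h), max_eq_left (sub_nonneg.2 h),
        max_eq_right (sub_nonpos.2 h'), max_eq_left (sub_nonneg.2 h')]
      nlinarith
    · rw [max_eq_right (sub_nonpos.2 h), max_eq_left (sub_nonneg.2 h),
        max_eq_left (sub_nonneg.2 h'), max_eq_right (sub_nonpos.2 h')]
      nlinarith [mul_nonneg (sub_nonneg.2 h) (sub_nonneg.2 h')]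
    · rw [max_eq_left (sub_nonneg.2 h), max_eq_right (sub_nonpos.2 h),
        max_eq_right (sub_nonpos.2 h'), max_eq_left (sub_nonneg.2 h')]
      nlinarith [mul_nonneg (sub_nonneg.2 h) (sub_nonneg.2 h')]
    · rw [max_eq_left (sub_nonneg.2 h), max_eq_right (sub_nonpos.2 h),
        max_eq_left (sub_nonneg.2 h'), max_eq_right (sub_nonpos.2 h')]
      nlinarith
  rw [← sum_mul_sub_eq_dirichlet hd hreg f] at hen
  set R := ∑ x, f x * (f x - (∑ y ∈ G.neighborFinset x, f y) / (d : ℝ))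
  have hall : c ^ 2 * ∑ x, f x ^ 2 ≤ 4 * d * (2 * d * R) :=
    calc c ^ 2 * ∑ x, f x ^ 2
        ≤ c ^ 2 * (∑ x, max (f x - m) 0 ^ 2 + ∑ x, max (m - f x) 0 ^ 2) :=
          mul_le_mul_of_nonneg_left hsq (sq_nonneg c)
      _ ≤ 4 * d * (∑ x, ∑ y ∈ G.neighborFinset x, (max (f x - m) 0 - max (f y - m) 0) ^ 2 +
          ∑ x, ∑ y ∈ G.neighborFinset x, (max (m - f x) 0 - max (m - f y) 0) ^ 2) := by
        rw [mul_add, mul_add]; exact add_le_add hp hn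
      _ ≤ 4 * d * (2 * d * R) := mul_le_mul_of_nonneg_left hen (by positivity)
  rw [div_mul_eq_mul_div, div_le_iff₀ (by positivity)]
  linarith

end Cheeger

/-! ### A subcritical recursion and the maximum principle. -/

open Filter Topology

/-- A bounded solution of a strictly subcritical recursion decays at least by `1 / 2` per step. -/
theorem two_mul_succ_le_of_recursion {a : ℕ → ℝ} {γ M : ℝ} (hγ : 0 < γ) (h0 : ∀ n, 0 ≤ a n)
    (hM : ∀ n, a n ≤ M)
    (hrec : ∀ n, (3 + 3 * γ) * a (n + 1) ≤ a n + 2 * a (n + 2)) (n : ℕ) :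
    2 * a (n + 1) ≤ a n := by
  -- Once this difference reaches some `δ > 0`, later terms are at least `δ / 2`; the `γ` term then
  -- makes the difference grow linearly, contradicting boundedness.
  have hmono : Monotone fun n => 2 * a (n + 1) - a n :=
    monotone_nat_of_le_succ fun n => by
      have h1 := hrec n
      have h2 := mul_nonneg hγ.le (h0 (n + 1))
      linarith
  by_contra! hcon
  set δ := 2 * a (n + 1) - a n with hδ
  have hδ0 : 0 < δ := by linarith
  have hstep : ∀ k, n ≤ k → a k + δ ≤ 2 * a (k + 1) := fun k hk => by
    have := hmono hk
    simp only at this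
    linarith
  have hlow : ∀ k, n ≤ k → δ / 2 ≤ a (k + 1) := fun k hk => by
    linarith [hstep k hk, h0 k]
  have hgrow : ∀ j : ℕ, j * (3 * γ * (δ / 2)) ≤ 2 * a (n + j + 1) - a (n + j) := by
    intro j
    induction j with
    | zero => rw [Nat.cast_zero, zero_mul]; exact hδ0.le
    | succ j ih =>
      have h1 := hrec (n + j)
      have h2 := mul_le_mul_of_nonneg_left (hlow (n + j) (by omega)) (by positivity : 0 ≤ 3 * γ)
      push_cast
      have e : n + (j + 1) = n + j + 1 := by ring
      rw [e]
      linarith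
  obtain ⟨j, hj⟩ := exists_nat_gt (2 * M / (3 * γ * (δ / 2)))
  rw [div_lt_iff₀ (by positivity)] at hj
  linarith [hgrow j, hM (n + j + 1), h0 (n + j)]

/-- A value above `κ` would force a global maximum to be attained; harmonicity passes it from child
to child into levels where `h` is close to `κ`. -/
theorem IsGraphHarmonic.le_of_tendsto {H : ∀ n : ℕ, SimpleGraph (Level n)} {h : TreeVertex → ℝ}
    (hh : IsGraphHarmonic (treeWithLevels H) h) {κ : ℝ}
    (hlim : ∀ ε > 0, ∃ N : ℕ, ∀ v : TreeVertex, N ≤ v.1 → |h v - κ| < ε) (v : TreeVertex) :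
    h v ≤ κ := by
  by_contra! hv
  obtain ⟨N, hN⟩ := hlim (h v - κ) (by linarith)
  obtain ⟨w, hw, hmax⟩ := Set.exists_max_image _ h (finite_treeVertex_level_le (max N v.1))
    ⟨v, (le_max_right N v.1 : v.1 ≤ max N v.1)⟩
  have hvw : h v ≤ h w := hmax v (le_max_right N v.1 : v.1 ≤ max N v.1)
  have hglob : ∀ u, h u ≤ h w := fun u => by
    rcases le_total u.1 (max N v.1) with hu | hu
    · exact hmax u hu
    · have := (abs_lt.1 (hN u ((le_max_left _ _).trans hu))).2
      linarith
  have hprop : ∀ k : ℕ, ∃ u : TreeVertex, u.1 = w.1 + k ∧ h u = h w := by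
    intro k
    induction k with
    | zero => exact ⟨w, rfl, rfl⟩
    | succ k ih =>
      obtain ⟨u, hu, huw⟩ := ih
      refine ⟨⟨u.1 + 1, childLevel u.2 false⟩, by simp only; omega, ?_⟩
      have hmem := childLevel_mem_neighborFinset H u.2 false
      have hsum : ∑ z ∈ (treeWithLevels H).neighborFinset u, (h w - h z) = 0 := by
        rw [Finset.sum_sub_distrib, ← hh u, huw]
        simp
      have := (Finset.sum_eq_zero_iff_of_nonneg fun z _ => sub_nonneg.2 (hglob z)).1 hsum _ hmem
      linarith
  obtain ⟨u, hu, huw⟩ := hprop N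
  have := (abs_lt.1 (hN u (by omega))).2
  linarith

theorem IsGraphHarmonic.neg {V : Type*} {G : SimpleGraph V} [G.LocallyFinite] {h : V → ℝ}
    (hh : IsGraphHarmonic G h) : IsGraphHarmonic G fun v => -h v := fun v => by
  rw [Finset.sum_neg_distrib, ← hh v]
  ring

/-! ### Means and deviations on levels. -/

/-- The mean of `h` over the `n`-th level. -/
noncomputable def levelMean (h : TreeVertex → ℝ) (n : ℕ) : ℝ :=
  (∑ x : Level n, h ⟨n, x⟩) / 2 ^ n

/-- The deviation of `h` from its mean over the `n`-th level. -/
noncomputable def levelDeviation (h : TreeVertex → ℝ) (n : ℕ) (x : Level n) : ℝ :=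
  h ⟨n, x⟩ - levelMean h n

/-- The Euclidean norm of the deviation of `h` from its mean over the `n`-th level. -/
noncomputable def levelNorm (h : TreeVertex → ℝ) (n : ℕ) : ℝ :=
  √(∑ x, levelDeviation h n x ^ 2)

theorem sum_eq_pow_mul_levelMean (h : TreeVertex → ℝ) (n : ℕ) :
    ∑ x : Level n, h ⟨n, x⟩ = 2 ^ n * levelMean h n := by
  rw [levelMean]
  field_simp

theorem sum_levelDeviation (h : TreeVertex → ℝ) (n : ℕ) : ∑ x, levelDeviation h n x = 0 := by
  simp [levelDeviation, Finset.sum_sub_distrib, sum_eq_pow_mul_levelMean]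

theorem abs_levelMean_le {h : TreeVertex → ℝ} {M : ℝ} (hM : ∀ v, |h v| ≤ M) (n : ℕ) :
    |levelMean h n| ≤ M := by
  rw [levelMean, abs_div, abs_of_pos (by positivity : (0 : ℝ) < 2 ^ n), div_le_iff₀ (by positivity)]
  refine (Finset.abs_sum_le_sum_abs _ _).trans ((Finset.sum_le_sum fun x _ => hM _).trans ?_)
  simp [mul_comm]

theorem abs_levelDeviation_le_levelNorm (h : TreeVertex → ℝ) (n : ℕ) (x : Level n) :
    |levelDeviation h n x| ≤ levelNorm h n := by
  rw [levelNorm, ← Real.sqrt_sq_eq_abs]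
  exact Real.sqrt_le_sqrt (Finset.single_le_sum (f := fun x => levelDeviation h n x ^ 2)
    (fun _ _ => sq_nonneg _) (Finset.mem_univ x))

theorem levelNorm_sq (h : TreeVertex → ℝ) (n : ℕ) :
    levelNorm h n ^ 2 = ∑ x, levelDeviation h n x ^ 2 :=
  Real.sq_sqrt (Finset.sum_nonneg fun _ _ => sq_nonneg _)

theorem levelNorm_nonneg (h : TreeVertex → ℝ) (n : ℕ) : 0 ≤ levelNorm h n := Real.sqrt_nonneg _

theorem levelNorm_le {h : TreeVertex → ℝ} {M : ℝ} (hM : ∀ v, |h v| ≤ M) (n : ℕ) :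
    levelNorm h n ≤ √2 ^ n * (2 * M) := by
  have hM0 : 0 ≤ M := (abs_nonneg _).trans (hM ⟨0, Fin.elim0⟩)
  refine Real.sqrt_le_iff.2 ⟨by positivity, ?_⟩
  have h1 : ∀ x : Level n, levelDeviation h n x ^ 2 ≤ (2 * M) ^ 2 := fun x => by
    rw [← sq_abs]
    refine pow_le_pow_left₀ (abs_nonneg _) ((abs_sub _ _).trans ?_) 2
    linarith [hM ⟨n, x⟩, abs_levelMean_le hM n]
  refine (Finset.sum_le_sum fun x _ => h1 x).trans (le_of_eq ?_)
  rw [mul_pow (√2 ^ n), ← pow_mul, mul_comm n 2, pow_mul, Real.sq_sqrt zero_le_two]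
  simp

/-! ### Recursions for harmonic functions, and the Liouville property. -/

section Recursion

variable {H : ∀ n : ℕ, SimpleGraph (Level n)} [∀ n, (H n).LocallyFinite] {h : TreeVertex → ℝ}

theorem IsGraphHarmonic.six_mul_eq (hh : IsGraphHarmonic (treeWithLevels H) h) {n : ℕ}
    (hreg : (H (n + 1)).IsRegularOfDegree 3) (x : Level (n + 1)) :
    6 * h ⟨n + 1, x⟩ = h ⟨n, Fin.init x⟩ +
      (h ⟨n + 2, childLevel x false⟩ + h ⟨n + 2, childLevel x true⟩) +
        ∑ y ∈ (H (n + 1)).neighborFinset x, h ⟨n + 1, y⟩ := by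
  rw [← sum_neighborFinset_succ, ← hh, degree_treeWithLevels_succ, hreg.degree_eq x]
  norm_num

/-- Sum the harmonic equation over a level: by regularity the level edges absorb three of the six
units, and each parent is counted twice. -/
theorem IsGraphHarmonic.three_mul_levelMean (hh : IsGraphHarmonic (treeWithLevels H) h) {n : ℕ}
    (hreg : (H (n + 1)).IsRegularOfDegree 3) :
    3 * levelMean h (n + 1) = levelMean h n + 2 * levelMean h (n + 2) := by
  have h1 := Finset.sum_congr (rfl : (Finset.univ : Finset (Level (n + 1))) = _)
    fun x _ => hh.six_mul_eq hreg x
  rw [← Finset.mul_sum, Finset.sum_add_distrib, Finset.sum_add_distrib,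
    sum_level_init fun x => h ⟨n, x⟩, ← sum_level_succ fun x => h ⟨n + 2, x⟩,
    sum_sum_neighborFinset_right hreg fun x => h ⟨n + 1, x⟩, sum_eq_pow_mul_levelMean,
    sum_eq_pow_mul_levelMean, sum_eq_pow_mul_levelMean] at h1
  have hpos : (0 : ℝ) < 2 ^ (n + 1) := by positivity
  refine mul_left_cancel₀ hpos.ne' ?_
  push_cast at h1
  linear_combination h1

theorem IsGraphHarmonic.six_mul_levelDeviation (hh : IsGraphHarmonic (treeWithLevels H) h)
    {n : ℕ} (hreg : (H (n + 1)).IsRegularOfDegree 3) (x : Level (n + 1)) :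
    6 * levelDeviation h (n + 1) x = levelDeviation h n (Fin.init x) +
      (levelDeviation h (n + 2) (childLevel x false) +
        levelDeviation h (n + 2) (childLevel x true)) +
        ∑ y ∈ (H (n + 1)).neighborFinset x, levelDeviation h (n + 1) y := by
  simp only [levelDeviation, Finset.sum_sub_distrib, Finset.sum_const,
    SimpleGraph.card_neighborFinset_eq_degree, hreg.degree_eq x, nsmul_eq_mul]
  push_cast
  linarith [hh.six_mul_eq hreg x, hh.three_mul_levelMean hreg]

/-- Cauchy–Schwarz; each parent value occurs twice, whence `√2`. -/
theorem sum_levelDeviation_mul_init_le (h : TreeVertex → ℝ) (n : ℕ) :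
    ∑ y, levelDeviation h (n + 1) y * levelDeviation h n (Fin.init y) ≤
      √2 * levelNorm h n * levelNorm h (n + 1) := by
  refine (Real.sum_mul_le_sqrt_mul_sqrt _ _ _).trans (le_of_eq ?_)
  rw [sum_level_init fun x => levelDeviation h n x ^ 2, Real.sqrt_mul zero_le_two]
  simp only [levelNorm]
  ring

theorem IsGraphHarmonic.levelNorm_recursion (hh : IsGraphHarmonic (treeWithLevels H) h)
    {n : ℕ} {γ : ℝ} (hreg : (H (n + 1)).IsRegularOfDegree 3)
    (hgap : SpectralGapAtLeast (H (n + 1)) 3 γ) :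
    (3 + 3 * γ) * levelNorm h (n + 1) ≤ √2 * levelNorm h n + √2 * levelNorm h (n + 2) := by
  have h1 := hgap _ (sum_levelDeviation h (n + 1))
  rw [← levelNorm_sq] at h1
  -- The pairing with the children is the parent pairing one level further down, so one estimate
  -- bounds both.
  have h2 : 3 * ∑ x, levelDeviation h (n + 1) x * (levelDeviation h (n + 1) x -
      (∑ y ∈ (H (n + 1)).neighborFinset x, levelDeviation h (n + 1) y) / ((3 : ℕ) : ℝ)) =
      ∑ x, levelDeviation h (n + 1) x * levelDeviation h n (Fin.init x) +
      ∑ y, levelDeviation h (n + 2) y * levelDeviation h (n + 1) (Fin.init y) -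
      3 * levelNorm h (n + 1) ^ 2 := by
    rw [levelNorm_sq, sum_level_succ fun y =>
        levelDeviation h (n + 2) y * levelDeviation h (n + 1) (Fin.init y), Finset.mul_sum, Finset.mul_sum, ← Finset.sum_add_distrib,
      ← Finset.sum_sub_distrib]
    refine Finset.sum_congr rfl fun x _ => ?_
    simp only [init_childLevel]
    push_cast
    linear_combination levelDeviation h (n + 1) x * hh.six_mul_levelDeviation hreg x
  have h3 := sum_levelDeviation_mul_init_le h n
  have h4 := sum_levelDeviation_mul_init_le h (n + 1)
  rcases (levelNorm_nonneg h (n + 1)).eq_or_lt with h0 | h0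
  · rw [← h0, mul_zero]
    have := levelNorm_nonneg h n
    have := levelNorm_nonneg h (n + 2)
    positivity
  · refine le_of_mul_le_mul_right ?_ h0
    linear_combination 3 * h1 + h2 + h3 + h4

theorem IsGraphHarmonic.levelNorm_tendsto_zero (hh : IsGraphHarmonic (treeWithLevels H) h)
    {γ M : ℝ} (hγ : 0 < γ) (hM : ∀ v, |h v| ≤ M)
    (hreg : ∀ n, 2 ≤ n → (H n).IsRegularOfDegree 3)
    (hgap : ∀ n, 2 ≤ n → SpectralGapAtLeast (H n) 3 γ) :
    Tendsto (levelNorm h) atTop (𝓝 0) := by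
  have hs : (0 : ℝ) < √2 := by positivity
  have hs2 : √2 * √2 = 2 := Real.mul_self_sqrt zero_le_two
  -- The scaling makes the sequence bounded; the shift by one puts the middle term of the recursion
  -- on levels `≥ 2`, where the hypotheses hold.
  let a : ℕ → ℝ := fun n => levelNorm h (n + 1) / √2 ^ (n + 1)
  have ha : ∀ n, levelNorm h (n + 1) = √2 ^ (n + 1) * a n := fun n => by
    simp only [a]
    field_simp
  have hdecay : ∀ n, 2 * a (n + 1) ≤ a n := by
    refine two_mul_succ_le_of_recursion (M := 2 * M) hγ
      (fun n => div_nonneg (levelNorm_nonneg _ _) (by positivity)) (fun n => ?_) fun n => ?_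
    · rw [div_le_iff₀ (by positivity), mul_comm]
      exact levelNorm_le hM _
    · have hrec := hh.levelNorm_recursion (hreg (n + 2) (by omega)) (hgap (n + 2) (by omega))
      rw [ha, ha, ha] at hrec
      refine le_of_mul_le_mul_left ?_ (pow_pos hs (n + 2))
      calc √2 ^ (n + 2) * ((3 + 3 * γ) * a (n + 1))
          = (3 + 3 * γ) * (√2 ^ (n + 1 + 1) * a (n + 1)) := by ring
        _ ≤ _ := hrec
        _ = √2 ^ (n + 2) * (a n + (√2 * √2) * a (n + 2)) := by ring
        _ = _ := by rw [hs2]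
  have hbound : ∀ n, levelNorm h (n + 1) ≤ levelNorm h 1 * (√2 / 2) ^ n := by
    intro n
    induction n with
    | zero => simp
    | succ n ih =>
      have : levelNorm h (n + 1 + 1) ≤ levelNorm h (n + 1) * (√2 / 2) := by
        rw [ha, ha, pow_succ √2 (n + 1)]
        have := mul_le_mul_of_nonneg_left (hdecay n)
          (by positivity : 0 ≤ √2 ^ (n + 1) * (√2 / 2))
        linarith
      calc _ ≤ _ := this
        _ ≤ levelNorm h 1 * (√2 / 2) ^ n * (√2 / 2) := by gcongr
        _ = _ := by ring
  have hlt : √2 / 2 < 1 := by nlinarith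
  rw [← tendsto_add_atTop_iff_nat 1]
  refine squeeze_zero (fun n => levelNorm_nonneg _ _) hbound ?_
  simpa using (tendsto_pow_atTop_nhds_zero_of_lt_one (by positivity) hlt).const_mul (levelNorm h 1)

theorem IsGraphHarmonic.exists_levelMean_tendsto (hh : IsGraphHarmonic (treeWithLevels H) h)
    (hreg : ∀ n, 2 ≤ n → (H n).IsRegularOfDegree 3) :
    ∃ κ, Tendsto (levelMean h) atTop (𝓝 κ) := by
  -- The recursion conserves `2 * levelMean h (n + 1) - levelMean h n` from `n = 1` on, and a limit
  -- of the means must equal it.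
  refine ⟨2 * levelMean h 2 - levelMean h 1, ?_⟩
  set κ := 2 * levelMean h 2 - levelMean h 1 with hκ
  have h1 : ∀ n, 2 * levelMean h (n + 2) - levelMean h (n + 1) = κ := by
    intro n
    induction n with
    | zero => rfl
    | succ n ih =>
      have := hh.three_mul_levelMean (hreg (n + 2) (by omega))
      linarith
  have h2 : ∀ n, levelMean h (n + 1) = κ + (levelMean h 1 - κ) * (1 / 2) ^ n := by
    intro n
    induction n with
    | zero => simp
    | succ n ih =>
      rw [pow_succ]
      linarith [h1 n]
  rw [← tendsto_add_atTop_iff_nat 1]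
  rw [funext h2]
  simpa using ((tendsto_pow_atTop_nhds_zero_of_lt_one (by norm_num : (0 : ℝ) ≤ 1 / 2)
    (by norm_num)).const_mul (levelMean h 1 - κ)).const_add κ

theorem isLiouvilleGraph_treeWithLevels {γ : ℝ} (hγ : 0 < γ)
    (hreg : ∀ n, 2 ≤ n → (H n).IsRegularOfDegree 3)
    (hgap : ∀ n, 2 ≤ n → SpectralGapAtLeast (H n) 3 γ) :
    IsLiouvilleGraph (treeWithLevels H) := by
  rintro h hh ⟨M, hM⟩
  obtain ⟨κ, hκ⟩ := hh.exists_levelMean_tendsto hreg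
  have hlim : ∀ ε > 0, ∃ N : ℕ, ∀ v : TreeVertex, N ≤ v.1 → |h v - κ| < ε := by
    intro ε hε
    have hsum := (hh.levelNorm_tendsto_zero hγ hM hreg hgap).add (hκ.sub_const κ).abs
    rw [sub_self, abs_zero, add_zero] at hsum
    obtain ⟨N, hN⟩ := eventually_atTop.1 (hsum.eventually_lt_const hε)
    refine ⟨N, fun v hv => lt_of_le_of_lt ?_ (hN v.1 hv)⟩
    calc |h v - κ| = |levelDeviation h v.1 v.2 + (levelMean h v.1 - κ)| := by
          rw [levelDeviation]; congr 1; ring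
      _ ≤ |levelDeviation h v.1 v.2| + |levelMean h v.1 - κ| := abs_add_le _ _
      _ ≤ _ := by gcongr; exact abs_levelDeviation_le_levelNorm _ _ _
  have heq : ∀ v, h v = κ := fun v => by
    refine le_antisymm (hh.le_of_tendsto hlim v) (neg_le_neg_iff.1 ?_)
    -- The lower bound is the maximum principle for `-h`.
    refine hh.neg.le_of_tendsto (κ := -κ) (fun ε hε => ?_) v
    obtain ⟨N, hN⟩ := hlim ε hε
    exact ⟨N, fun v hv => by rw [neg_sub_neg, abs_sub_comm]; exact hN v hv⟩
  intro u v
  rw [heq u, heq v]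

end Recursion

theorem mainTheorem1 (H : ∀ n : ℕ, SimpleGraph (Level n)) [∀ n, (H n).LocallyFinite]
    (hH : IsCubicExpanderFamily H) :
    (∀ v : TreeVertex, (treeWithLevels H).degree v ≤ 6) ∧
      IsNonamenableGraph (treeWithLevels H) ∧ IsLiouvilleGraph (treeWithLevels H) := by
  obtain ⟨hreg, hexp⟩ := hH
  refine ⟨degree_treeWithLevels_le H hreg, isNonamenableGraph_treeWithLevels H, ?_⟩
  rcases hexp with ⟨γ, hγ, hgap⟩ | ⟨c, hc, hiso⟩
  · exact isLiouvilleGraph_treeWithLevels hγ hreg hgap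
  · exact isLiouvilleGraph_treeWithLevels (γ := c ^ 2 / (8 * (3 : ℕ) ^ 2)) (by positivity) hreg
      fun n hn => (hiso n hn).spectralGapAtLeast hc.le (by norm_num) (hreg n hn)
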